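/- Let $\Lambda$ be a hereditary artin algebra (an algebra, finitely generated as a module, over a commutative artinian ring, all of whose right ideals are projective), let $\operatorname{mod}\Lambda$ be the category of finitely generated right $\Lambda$-modules, and let $U\in\operatorname{mod}\Lambda$ be rigid, i.e. $\operatorname{Ext}^1_\Lambda(U,U)=0$. Let $\operatorname{add}U$ be the class of direct summands of finite direct sums of copies of $U$; let $\operatorname{cok}U$ be the full subcategory of $\operatorname{mod}\Lambda$ of modules isomorphic to the cokernel of some map $U_1\to U_0$ with $U_0,U_1\in\operatorname{add}U$; and let $\mathcal X_U$ be the full subcategory of modules $X$ for which there is an exact sequence $\cdots\xrightarrow{f_2}U_1\xrightarrow{f_1}U_0\xrightarrow{f_0}X\to 0$ with all $U_i\in\operatorname{add}U$ and $\operatorname{Ext}^{j}_\Lambda(U,\operatorname{Im}f_i)=0$ for all $j>0$ and $i\ge 0$. 1. For $X\in\operatorname{mod}\Lambda$ the following are equivalent: (a) $X\in\mathcal X_U$; (b) $X\in\operatorname{cok}U$; (c) there is a short exact sequence $0\to U_1\to U_0\to X\to 0$ with $U_1,U_0\in\operatorname{add}U$. 2. $\operatorname{cok}U$ is an ICE-closed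 subcategory of $\operatorname{mod}\Lambda$: it is closed under isomorphisms, finite direct sums and direct summands; for every map $f\colon M\to N$ with $M,N\in\operatorname{cok}U$ the modules $\operatorname{Im}f$ and $\operatorname{Coker}f$ lie in $\operatorname{cok}U$; and for every short exact sequence $0\to L\to M\to N\to 0$ in $\operatorname{mod}\Lambda$ with $L,N\in\operatorname{cok}U$ one has $M\in\operatorname{cok}U$. 3. $U$ is an $\operatorname{Ext}$-progenerator of $\mathcal C=\operatorname{cok}U$: one has $U\in\mathcal C$; the class $\operatorname{add}U$ is equal to the class $\mathcal P(\mathcal C)$ of all $P\in\mathcal C$ with $\operatorname{Ext}^1_\Lambda(P,Y)=0$ for every $Y\in\mathcal C$; and every $X\in\mathcal C$ admits a short exact sequence $0\to Y\to P\to X\to 0$ with $P\in\mathcal P(\mathcal C)$ and $Y\in\mathcal C$. -/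

import Mathlib

open CategoryTheory CategoryTheory.Limits CategoryTheory.Abelian

universe w u v

/-- A ring `Λ` is right hereditary if every right ideal of `Λ` is a projective right module.
(A right ideal is a `Λᵐᵒᵖ`-submodule of `Λ`.) -/
def IsRightHereditary (Λ : Type u) [Ring Λ] : Prop :=
  ∀ I : Submodule Λᵐᵒᵖ Λ, Module.Projective Λᵐᵒᵖ I

/-- `Λ` is an artin `R`-algebra: `R` is a commutative artinian ring and `Λ` is an `R`-algebra
which is finitely generated as an `R`-module. -/
structure IsArtinAlgebra (R : Type w) (Λ : Type u) [CommRing R] [Ring Λ] [Algebra R Λ] :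
    Prop where
  isArtinianRing : IsArtinianRing R
  finite : Module.Finite R Λ

/-- The category of all right `Λ`-modules, i.e. of left modules over the opposite ring. -/
abbrev RightMod (Λ : Type u) [Ring Λ] := ModuleCat.{u} Λᵐᵒᵖ

/-- The (full, isomorphism-closed) subcategory `mod Λ` of finitely generated right modules. -/
abbrev fgRightMod (Λ : Type u) [Ring Λ] : ObjectProperty (RightMod Λ) :=
  ModuleCat.isFG Λᵐᵒᵖ

section Abelian

attribute [local instance] CategoryTheory.Abelian.hasFiniteBiproducts

variable {A : Type u} [Category.{v} A] [Abelian A]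

/-- `add U`: the direct summands of finite direct sums of copies of `U`. -/
def addCat (U : A) : ObjectProperty A := fun X =>
  ∃ (n : ℕ) (Y : A), Nonempty (X ⊞ Y ≅ ⨁ (fun _ : Fin n => U))

/-- `cok U`: the cokernels of morphisms in `add U`. -/
def cokCat (U : A) : ObjectProperty A := fun X =>
  ∃ (U₁ U₀ : A) (f : U₁ ⟶ U₀), addCat U U₁ ∧ addCat U U₀ ∧ Nonempty (X ≅ cokernel f)

/-- There is a short exact sequence `0 ⟶ U₁ ⟶ U₀ ⟶ X ⟶ 0` with `U₁` and `U₀` in `add U`. -/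
def HasShortAddPresentation (U X : A) : Prop :=
  ∃ (U₁ U₀ : A) (i : U₁ ⟶ U₀) (p : U₀ ⟶ X) (hip : i ≫ p = 0),
    addCat U U₁ ∧ addCat U U₀ ∧ (ShortComplex.mk i p hip).ShortExact

/-- `C` is closed under images of morphisms between objects of `C`. -/
def IsClosedUnderImages (C : ObjectProperty A) : Prop :=
  ∀ ⦃M N : A⦄ (f : M ⟶ N), C M → C N → C (image f)

/-- `C` is closed under cokernels of morphisms between objects of `C`. -/
def IsClosedUnderCokers (C : ObjectProperty A) : Prop :=
  ∀ ⦃M N : A⦄ (f : M ⟶ N), C M → C N → C (cokernel f)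

/-- `C` is closed under extensions. -/
def IsClosedUnderExts (C : ObjectProperty A) : Prop :=
  ∀ ⦃S : ShortComplex A⦄, S.ShortExact → C S.X₁ → C S.X₃ → C S.X₂

/-- A full subcategory, given by its objects, is closed under isomorphisms, finite direct sums
(including the empty one) and direct summands. -/
structure IsAddSubcategory (C : ObjectProperty A) : Prop where
  iso : ∀ ⦃X Y : A⦄, Nonempty (X ≅ Y) → C X → C Y
  zero : ∀ ⦃Z : A⦄, IsZero Z → C Z
  sum : ∀ ⦃X Y : A⦄, C X → C Y → C (X ⊞ Y)
  summand : ∀ ⦃X Y : A⦄, C (X ⊞ Y) → C X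

variable [HasExt.{v} A]

/-- `Ext^i(X, Y) = 0`. -/
def ExtVanishes (X Y : A) (i : ℕ) : Prop := Subsingleton (Ext X Y i)

/-- `U` is rigid: `Ext¹(U, U) = 0`. -/
def IsRigid (U : A) : Prop := ExtVanishes U U 1

/-- The subcategory `𝒳_U`: objects `X` that admit an exact sequence
`⋯ ⟶ U₂ ⟶ U₁ ⟶ U₀ ⟶ X ⟶ 0`, with maps `d i : U_{i+1} ⟶ U_i` and `p : U₀ ⟶ X`, such that every
`U_i` lies in `add U` and `Ext^{>0}(U, -)` vanishes on the images of `p` and of all the `d i`. -/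
def resolvedCat (U : A) : ObjectProperty A := fun X =>
  ∃ (T : ℕ → A) (d : ∀ i, T (i + 1) ⟶ T i) (p : T 0 ⟶ X)
    (hp : d 0 ≫ p = 0) (hd : ∀ i, d (i + 1) ≫ d i = 0),
    (∀ i, addCat U (T i)) ∧
    Epi p ∧ (ShortComplex.mk (d 0) p hp).Exact ∧
    (∀ i, (ShortComplex.mk (d (i + 1)) (d i) (hd i)).Exact) ∧
    (∀ j, 0 < j → ExtVanishes U (image p) j) ∧
    (∀ i j, 0 < j → ExtVanishes U (image (d i)) j)

/-- The subcategory `𝒫(C)` of the Ext-projective objects `X` in `C`: `X` lies in `C` and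
`Ext¹(X, C) = 0`. -/
def extProjectives (C : ObjectProperty A) : ObjectProperty A := fun X =>
  C X ∧ ∀ Y : A, C Y → ExtVanishes X Y 1

/-- `C` has enough Ext-projectives: every `X` in `C` admits a short exact sequence
`0 ⟶ Y ⟶ P ⟶ X ⟶ 0` with `P` Ext-projective in `C` and `Y` in `C`. -/
def HasEnoughExtProjectives (C : ObjectProperty A) : Prop :=
  ∀ X : A, C X → ∃ (Y P : A) (i : Y ⟶ P) (p : P ⟶ X) (hip : i ≫ p = 0),
    C Y ∧ extProjectives C P ∧ (ShortComplex.mk i p hip).ShortExact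

/-- `P` is an Ext-progenerator of `C`. -/
structure IsExtProgenerator (C : ObjectProperty A) (P : A) : Prop where
  mem : C P
  add_eq : addCat P = extProjectives C
  enough : HasEnoughExtProjectives C

end Abelian

/-- `C` is an ICE-closed subcategory of `mod Λ`. As `mod Λ` is closed under quotients, and under
images and extensions, inside the category of all modules when `Λ` is an artin algebra, images,
cokernels and short exact sequences can be formed there. -/
structure IsICEClosed {Λ : Type u} [Ring Λ] (C : ObjectProperty (RightMod Λ)) : Prop where
  le_fg : C ≤ fgRightMod Λ
  isAddSubcategory : IsAddSubcategory C
  image : IsClosedUnderImages C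
  cokernel : IsClosedUnderCokers C
  extension : IsClosedUnderExts C

/-! ### Objects of `add U` via factorizations of the identity. -/

section Abelian

attribute [local instance] CategoryTheory.Abelian.hasFiniteBiproducts

variable {A : Type u} [Category.{v} A] [Abelian A]

/-! Heredity enters only as injective dimension at most 1 (`hdim`): `Ext²` vanishes, so `Ext¹(V, -)`
is right exact. Everything else happens in an abelian category with `Ext`. The crux is
`addCat_of_shortExact_of_epi`: for rigid `U`, the image of a map in `add U` is again in `add U`.
Replacing `f` by the inclusion of its image turns each cokernel presentation into a short exact one.
Then `Ext¹(U, -)` vanishes on `cok U`, so maps from `add U` lift along the epimorphisms in these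
presentations. Closure under cokernels, images and extensions follows by lifting and writing each
object as an explicit cokernel. A short presentation padded by zeros is a resolution defining `𝒳_U`,
and it splits when its end term is Ext-projective. -/

lemma addCat_of_sum_eq_id {U X : A} {ι : Type*} [Fintype ι] (s : ι → (X ⟶ U)) (r : ι → (U ⟶ X))
    (h : ∑ i, s i ≫ r i = 𝟙 X) : addCat U X := by
  let e := Fintype.equivFin ι
  let a : X ⟶ ⨁ (fun _ : Fin (Fintype.card ι) => U) := biproduct.lift fun i => s (e.symm i)
  let b : (⨁ (fun _ : Fin (Fintype.card ι) => U)) ⟶ X := biproduct.desc fun i => r (e.symm i)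
  have hab : a ≫ b = 𝟙 X := by
    rw [← h, biproduct.lift_desc]
    exact Equiv.sum_comp e.symm fun i => s i ≫ r i
  have : Mono a := mono_of_mono_fac hab
  let S := ShortComplex.mk a (cokernel.π a) (cokernel.condition a)
  have hS : S.Exact := ShortComplex.exact_cokernel a
  have hepi : Epi S.g := inferInstanceAs (Epi (cokernel.π a))
  exact ⟨_, _, ⟨(ShortComplex.Splitting.ofExactOfRetraction S hS b hab hepi).isoBinaryBiproduct.symm⟩⟩

/-- This form needs neither a complement nor a biproduct, so membership in `add U` reduces to
identities between morphisms. -/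
lemma addCat_iff_sum_eq_id {U X : A} : addCat U X ↔
    ∃ (n : ℕ) (s : Fin n → (X ⟶ U)) (r : Fin n → (U ⟶ X)), ∑ i, s i ≫ r i = 𝟙 X := by
  refine ⟨fun ⟨n, Y, ⟨e⟩⟩ => ⟨n, fun i => biprod.inl ≫ e.hom ≫ biproduct.π _ i,
    fun i => biproduct.ι (fun _ : Fin n => U) i ≫ e.inv ≫ biprod.fst, ?_⟩,
    fun ⟨_, s, r, h⟩ => addCat_of_sum_eq_id s r h⟩
  calc ∑ i, (biprod.inl ≫ e.hom ≫ biproduct.π (fun _ : Fin n => U) i) ≫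
        biproduct.ι (fun _ : Fin n => U) i ≫ e.inv ≫ biprod.fst
      = biprod.inl ≫ e.hom ≫ (∑ i, biproduct.π (fun _ : Fin n => U) i ≫
        biproduct.ι (fun _ : Fin n => U) i) ≫ e.inv ≫ biprod.fst := by
        simp only [Preadditive.comp_sum, Preadditive.sum_comp, Category.assoc]
    _ = 𝟙 X := by simp [biproduct.total]

lemma addCat_self (U : A) : addCat U U :=
  addCat_of_sum_eq_id (ι := Unit) (fun _ => 𝟙 U) (fun _ => 𝟙 U) (by simp)

lemma addCat_of_isZero (U : A) {Z : A} (hZ : IsZero Z) : addCat U Z :=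
  addCat_of_sum_eq_id (ι := Empty) (fun _ => 0) (fun _ => 0) (hZ.eq_of_src _ _)

/-- An object is in `add U` as soon as its identity is a sum of two morphisms factoring through
objects of `add U`. -/
lemma addCat_of_comp_add_comp {U X Y Z : A} (hY : addCat U Y) (hZ : addCat U Z)
    (a : X ⟶ Y) (b : Y ⟶ X) (c : X ⟶ Z) (d : Z ⟶ X) (h : a ≫ b + c ≫ d = 𝟙 X) :
    addCat U X := by
  obtain ⟨m, s, r, hsr⟩ := addCat_iff_sum_eq_id.1 hY
  obtain ⟨n, s', r', hsr'⟩ := addCat_iff_sum_eq_id.1 hZ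
  refine addCat_of_sum_eq_id (Sum.elim (fun i => a ≫ s i) (fun i => c ≫ s' i))
    (Sum.elim (fun i => r i ≫ b) (fun i => r' i ≫ d)) ?_
  have h₁ : a ≫ b = ∑ i, (a ≫ s i) ≫ r i ≫ b := by
    conv_lhs => rw [← Category.id_comp b, ← hsr]
    simp only [Preadditive.comp_sum, Preadditive.sum_comp, Category.assoc]
  have h₂ : c ≫ d = ∑ i, (c ≫ s' i) ≫ r' i ≫ d := by
    conv_lhs => rw [← Category.id_comp d, ← hsr']
    simp only [Preadditive.comp_sum, Preadditive.sum_comp, Category.assoc]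
  rw [Fintype.sum_sum_type, ← h, h₁, h₂]
  rfl

lemma addCat_of_retract {U X Y : A} (hY : addCat U Y) (a : X ⟶ Y) (b : Y ⟶ X)
    (h : a ≫ b = 𝟙 X) : addCat U X :=
  addCat_of_comp_add_comp hY hY a b 0 0 (by simp [h])

lemma addCat_biprod {U X Y : A} (hX : addCat U X) (hY : addCat U Y) : addCat U (X ⊞ Y) :=
  addCat_of_comp_add_comp hX hY biprod.fst biprod.inl biprod.snd biprod.inr biprod.total

/-! ### Objects of `cok U`. -/

/-- A weak cokernel that is an epimorphism is a cokernel. -/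
lemma nonempty_iso_cokernel {X Y Z : A} (f : X ⟶ Y) (g : Y ⟶ Z) [Epi g] (w : f ≫ g = 0)
    (H : ∀ ⦃T : A⦄ (h : Y ⟶ T), f ≫ h = 0 → ∃ l, g ≫ l = h) : Nonempty (Z ≅ cokernel f) := by
  obtain ⟨l, hl⟩ := H (cokernel.π f) (cokernel.condition f)
  refine ⟨⟨l, cokernel.desc f g w, ?_, ?_⟩⟩
  · rw [← cancel_epi g, reassoc_of% hl]; simp
  · rw [← cancel_epi (cokernel.π f)]; simp [hl]

lemma nonempty_iso_cokernel_of_exact {S : ShortComplex A} (hS : S.Exact) [Epi S.g] :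
    Nonempty (S.X₃ ≅ cokernel S.f) :=
  nonempty_iso_cokernel S.f S.g S.zero fun _ h hh => ⟨hS.desc h hh, hS.g_desc h hh⟩

lemma cokCat_of_iso {U X Y : A} (e : X ≅ Y) (hX : cokCat U X) : cokCat U Y := by
  obtain ⟨U₁, U₀, f, h₁, h₀, ⟨i⟩⟩ := hX
  exact ⟨U₁, U₀, f, h₁, h₀, ⟨e.symm ≪≫ i⟩⟩

lemma cokCat_of_exact {U : A} {S : ShortComplex A} (hS : S.Exact) [Epi S.g]
    (h₁ : addCat U S.X₁) (h₂ : addCat U S.X₂) : cokCat U S.X₃ :=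
  ⟨_, _, S.f, h₁, h₂, nonempty_iso_cokernel_of_exact hS⟩

lemma cokCat_of_hasShortAddPresentation {U X : A} (h : HasShortAddPresentation U X) :
    cokCat U X := by
  obtain ⟨U₁, U₀, i, p, hip, h₁, h₀, hS⟩ := h
  have := hS.epi_g
  exact cokCat_of_exact hS.exact h₁ h₀

lemma cokCat_of_addCat {U X : A} (h : addCat U X) : cokCat U X :=
  ⟨X, X, 0, h, h, ⟨cokernelZeroIsoTarget.symm⟩⟩

lemma cokCat_biprod {U X Y : A} (hX : cokCat U X) (hY : cokCat U Y) : cokCat U (X ⊞ Y) := by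
  obtain ⟨U₁, U₀, f, h₁, h₀, ⟨i⟩⟩ := hX
  obtain ⟨V₁, V₀, g, k₁, k₀, ⟨j⟩⟩ := hY
  let q := biprod.map (cokernel.π f ≫ i.inv) (cokernel.π g ≫ j.inv)
  refine ⟨_, _, biprod.map f g, addCat_biprod h₁ k₁, addCat_biprod h₀ k₀,
    nonempty_iso_cokernel _ q (by ext <;> simp [q]) fun T h hh => ?_⟩
  have e₁ : f ≫ biprod.inl ≫ h = 0 := by
    simpa using biprod.inl ≫= hh
  have e₂ : g ≫ biprod.inr ≫ h = 0 := by
    simpa using biprod.inr ≫= hh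
  exact ⟨biprod.desc (i.hom ≫ cokernel.desc f _ e₁) (j.hom ≫ cokernel.desc g _ e₂), by
    ext <;> simp [q]⟩

lemma summand_of_isClosedUnderCokers {C : ObjectProperty A}
    (hiso : ∀ ⦃X Y : A⦄, Nonempty (X ≅ Y) → C X → C Y) (hC : IsClosedUnderCokers C)
    {X Y : A} (h : C (X ⊞ Y)) : C X := by
  -- The idempotent with image `Y`; its cokernel is the projection to `X`.
  let e : X ⊞ Y ⟶ X ⊞ Y := biprod.snd ≫ biprod.inr
  obtain ⟨i⟩ := nonempty_iso_cokernel e biprod.fst (by simp [e]) fun T k hk => by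
    have hr : biprod.inr ≫ k = 0 := by simpa [e] using biprod.inr ≫= hk
    exact ⟨biprod.inl ≫ k, by ext <;> simp [hr]⟩
  exact hiso ⟨i.symm⟩ (hC e h h)

/-! ### Ext vanishing and short presentations. -/

variable [HasExt.{v} A]

lemma extVanishes_of_addCat_left {U X Y : A} {n : ℕ} (hX : addCat U X) (h : ExtVanishes U Y n) :
    ExtVanishes X Y n := by
  have : Subsingleton (Ext U Y n) := h
  obtain ⟨m, s, r, hsr⟩ := addCat_iff_sum_eq_id.1 hX
  refine subsingleton_of_forall_eq 0 fun x => ?_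
  rw [← Ext.mk₀_id_comp x, ← hsr, Ext.mk₀_sum, Ext.sum_comp]
  refine Finset.sum_eq_zero fun i _ => ?_
  rw [← Ext.mk₀_comp_mk₀_assoc, Subsingleton.elim ((Ext.mk₀ (r i)).comp x _) 0, Ext.comp_zero]

lemma extVanishes_of_addCat_right {U X Y : A} {n : ℕ} (hX : addCat U X) (h : ExtVanishes Y U n) :
    ExtVanishes Y X n := by
  have : Subsingleton (Ext Y U n) := h
  obtain ⟨m, s, r, hsr⟩ := addCat_iff_sum_eq_id.1 hX
  refine subsingleton_of_forall_eq 0 fun x => ?_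
  rw [← Ext.comp_mk₀_id x, ← hsr, Ext.mk₀_sum, Ext.comp_sum]
  refine Finset.sum_eq_zero fun i _ => ?_
  rw [← Ext.mk₀_comp_mk₀, ← Ext.comp_assoc_of_second_deg_zero,
    Subsingleton.elim (x.comp (Ext.mk₀ (s i)) _) 0, Ext.zero_comp]

lemma IsRigid.extVanishes {U X Y : A} (hU : IsRigid U) (hX : addCat U X) (hY : addCat U Y) :
    ExtVanishes X Y 1 :=
  extVanishes_of_addCat_left hX (extVanishes_of_addCat_right hY hU)

/-- If `Ext¹(V, -)` vanishes on the kernel of an epimorphism, morphisms from `V` lift along it. -/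
lemma exists_lift_of_extVanishes {S : ShortComplex A} (hS : S.ShortExact) {V : A}
    (h : ExtVanishes V S.X₁ 1) (g : V ⟶ S.X₃) : ∃ l : V ⟶ S.X₂, l ≫ S.g = g := by
  have : Subsingleton (Ext V S.X₁ 1) := h
  obtain ⟨x, hx⟩ := Ext.covariant_sequence_exact₃ V hS (Ext.mk₀ g) (zero_add 1)
    (Subsingleton.elim _ _)
  obtain ⟨l, rfl⟩ := (Ext.mk₀_bijective _ _).surjective x
  exact ⟨l, (Ext.mk₀_bijective _ _).injective (by simpa using hx)⟩

lemma extVanishes_one_of_shortExact (hdim : ∀ X : A, HasInjectiveDimensionLT X 2)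
    {S : ShortComplex A} (hS : S.ShortExact) {V : A} (h : ExtVanishes V S.X₂ 1) :
    ExtVanishes V S.X₃ 1 := by
  have : Subsingleton (Ext V S.X₂ 1) := h
  have := hdim S.X₁
  refine subsingleton_of_forall_eq 0 fun x => ?_
  obtain ⟨y, rfl⟩ := Ext.covariant_sequence_exact₃ V hS x rfl
    (Ext.eq_zero_of_hasInjectiveDimensionLT _ 2 le_rfl)
  rw [Subsingleton.elim y 0, Ext.zero_comp]

/-- In a hereditary category, if `0 ⟶ I ⟶ V ⟶ X ⟶ 0` is exact and `I` is a quotient of `W`,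
with `V` and `W` in `add U` and `U` rigid, then `I` is in `add U`. -/
lemma addCat_of_shortExact_of_epi (hdim : ∀ X : A, HasInjectiveDimensionLT X 2) {U : A}
    (hU : IsRigid U) {S : ShortComplex A} (hS : S.ShortExact) {W : A} (q : W ⟶ S.X₁) [Epi q]
    (hV : addCat U S.X₂) (hW : addCat U W) : addCat U S.X₁ := by
  have hq : (ShortComplex.mk (kernel.ι q) q (kernel.condition q)).ShortExact :=
    { exact := ShortComplex.exact_kernel q }
  have := hdim (kernel q)
  -- Since `Ext²(X, ker q) = 0`, the class of the sequence lifts along `q` to `e` in `Ext¹(X, W)`.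
  -- By rigidity `e` dies on `V`, so it is the pushout of the class along some `h : I ⟶ W`.
  obtain ⟨e, he⟩ := Ext.covariant_sequence_exact₃ S.X₃ hq hS.extClass rfl
    (Ext.eq_zero_of_hasInjectiveDimensionLT _ 2 le_rfl)
  have : Subsingleton (Ext S.X₂ W 1) := hU.extVanishes hV hW
  obtain ⟨x, hx⟩ := Ext.contravariant_sequence_exact₃ hS W e (Subsingleton.elim _ _) (add_zero 1)
  obtain ⟨h, rfl⟩ := (Ext.mk₀_bijective _ _).surjective x
  -- Pushing the class out along `h ≫ q` returns the class itself, so `𝟙 - h ≫ q` kills it and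
  -- extends along `S.f` to `k`. The identity of `I` thus factors through `W` and `V`.
  have key : hS.extClass.comp (Ext.mk₀ (𝟙 S.X₁ - h ≫ q)) (add_zero 1) = 0 := by
    rw [sub_eq_add_neg, Ext.mk₀_add, Ext.mk₀_neg, Ext.comp_add, Ext.comp_neg, Ext.comp_mk₀_id,
      ← Ext.mk₀_comp_mk₀, ← Ext.comp_assoc_of_third_deg_zero, hx]
    simpa [sub_eq_zero, ← sub_eq_add_neg] using he.symm
  obtain ⟨y, hy⟩ := Ext.contravariant_sequence_exact₁ hS S.X₁ _ _ key
  obtain ⟨k, rfl⟩ := (Ext.mk₀_bijective _ _).surjective y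
  have hk : S.f ≫ k = 𝟙 _ - h ≫ q := (Ext.mk₀_bijective _ _).injective (by simpa using hy)
  exact addCat_of_comp_add_comp hW hV h q S.f k (by rw [hk]; abel)

lemma addCat_image (hdim : ∀ X : A, HasInjectiveDimensionLT X 2) {U : A} (hU : IsRigid U)
    {X Y : A} (f : X ⟶ Y) (hX : addCat U X) (hY : addCat U Y) : addCat U (image f) := by
  have hS : (ShortComplex.mk (Limits.image.ι f) (cokernel.π (Limits.image.ι f))
    (cokernel.condition _)).ShortExact := { exact := ShortComplex.exact_cokernel _ }
  exact addCat_of_shortExact_of_epi hdim hU hS (factorThruImage f) hY hX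

lemma cokCat.hasShortAddPresentation (hdim : ∀ X : A, HasInjectiveDimensionLT X 2) {U : A}
    (hU : IsRigid U) {X : A} (hX : cokCat U X) : HasShortAddPresentation U X := by
  obtain ⟨U₁, U₀, f, h₁, h₀, ⟨i⟩⟩ := hX
  have w : Limits.image.ι f ≫ cokernel.π f ≫ i.inv = 0 := by
    rw [← cancel_epi (factorThruImage f)]; simp
  refine ⟨image f, U₀, Limits.image.ι f, cokernel.π f ≫ i.inv, w, addCat_image hdim hU f h₁ h₀, h₀, ?_⟩
  exact
    { exact := ShortComplex.exact_of_g_is_cokernel _ <|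
        CokernelCofork.IsColimit.ofπ' _ _ fun k hk =>
          ⟨i.hom ≫ cokernel.desc f k (by rw [← Limits.image.fac f, Category.assoc, hk, comp_zero]),
            by simp⟩
      mono_f := inferInstanceAs (Mono (Limits.image.ι f))
      epi_g := epi_comp _ _ }

lemma extVanishes_cokCat (hdim : ∀ X : A, HasInjectiveDimensionLT X 2) {U : A}
    (hU : IsRigid U) {V X : A} (hV : addCat U V) (hX : cokCat U X) : ExtVanishes V X 1 := by
  obtain ⟨U₁, U₀, i, p, hip, h₁, h₀, hS⟩ := hX.hasShortAddPresentation hdim hU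
  exact extVanishes_one_of_shortExact hdim hS (hU.extVanishes hV h₀)

/-! ### Closure properties of `cok U`. -/

/-- Lift `f` to a map `a` between the covers `U₀` and `V₀`: dividing `V₀` by the images of `j` and
`a` gives `N` modulo the image of `f`. -/
lemma isClosedUnderCokers_cokCat (hdim : ∀ X : A, HasInjectiveDimensionLT X 2) {U : A}
    (hU : IsRigid U) : IsClosedUnderCokers (cokCat U) := by
  intro M N f hM hN
  obtain ⟨_, U₀, _, m, _, _, h₀, hSM⟩ := hM.hasShortAddPresentation hdim hU
  obtain ⟨V₁, V₀, j, q, hjq, k₁, k₀, hSN⟩ := hN.hasShortAddPresentation hdim hU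
  have : Epi m := hSM.epi_g
  have : Epi q := hSN.epi_g
  obtain ⟨a, ha⟩ := exists_lift_of_extVanishes hSN (hU.extVanishes h₀ k₁) (m ≫ f)
  dsimp at ha
  refine ⟨_, _, biprod.desc a j, addCat_biprod h₀ k₁, k₀,
    nonempty_iso_cokernel _ (q ≫ cokernel.π f) ?_ fun T h hh => ?_⟩
  · ext
    · simp [reassoc_of% ha]
    · simp [reassoc_of% hjq]
  have e₁ : a ≫ h = 0 := by simpa using biprod.inl ≫= hh
  have e₂ : j ≫ h = 0 := by simpa using biprod.inr ≫= hh
  have e₃ : q ≫ hSN.exact.desc h e₂ = h := hSN.exact.g_desc h e₂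
  have e₄ : f ≫ hSN.exact.desc h e₂ = 0 := by
    rw [← cancel_epi m, comp_zero, ← Category.assoc, ← ha, Category.assoc, e₃, e₁]
  exact ⟨cokernel.desc f _ e₄, by simp [e₃]⟩

/-- With the same lift `a`, the image of `φ = (a, j)` is the preimage in `V₀` of the image of `f`.
It lies in `add U`, and its quotient by `V₁` is the image of `f`. -/
lemma isClosedUnderImages_cokCat (hdim : ∀ X : A, HasInjectiveDimensionLT X 2) {U : A}
    (hU : IsRigid U) : IsClosedUnderImages (cokCat U) := by
  intro M N f hM hN
  obtain ⟨_, U₀, _, m, _, _, h₀, hSM⟩ := hM.hasShortAddPresentation hdim hU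
  obtain ⟨V₁, V₀, j, q, hjq, k₁, k₀, hSN⟩ := hN.hasShortAddPresentation hdim hU
  have : Epi m := hSM.epi_g
  have : Mono j := hSN.mono_f
  obtain ⟨a, ha⟩ := exists_lift_of_extVanishes hSN (hU.extVanishes h₀ k₁) (m ≫ f)
  dsimp at ha
  let φ : U₀ ⊞ V₁ ⟶ V₀ := biprod.desc a j
  let c : V₁ ⟶ image φ := biprod.inr ≫ factorThruImage φ
  have hc : c ≫ Limits.image.ι φ = j := by simp [c, φ]
  have sq : CommSq (biprod.fst ≫ m ≫ factorThruImage f) (factorThruImage φ) (Limits.image.ι f)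
      (Limits.image.ι φ ≫ q) := ⟨by ext <;> simp [φ, ha, hjq]⟩
  let d : image φ ⟶ image f := sq.lift
  have hd₁ : factorThruImage φ ≫ d = biprod.fst ≫ m ≫ factorThruImage f := sq.fac_left
  have hd₂ : d ≫ Limits.image.ι f = Limits.image.ι φ ≫ q := sq.fac_right
  have : Epi (factorThruImage φ ≫ d) := by rw [hd₁]; infer_instance
  have hepi : Epi d := epi_of_epi (factorThruImage φ) d
  have hcd : c ≫ d = 0 := by
    rw [← cancel_mono (Limits.image.ι f), Category.assoc, hd₂, reassoc_of% hc, hjq, zero_comp]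
  let S := ShortComplex.mk c d hcd
  have hS : S.Exact := by
    rw [ShortComplex.exact_iff_exact_up_to_refinements]
    intro T x hx
    have hx' : (x ≫ Limits.image.ι φ) ≫ q = 0 := by
      change x ≫ d = 0 at hx
      rw [Category.assoc, ← hd₂, reassoc_of% hx, zero_comp]
    refine ⟨T, 𝟙 T, inferInstance, hSN.exact.lift _ hx', ?_⟩
    have : hSN.exact.lift _ hx' ≫ j = x ≫ Limits.image.ι φ := hSN.exact.lift_f _ hx'
    change 𝟙 T ≫ x = _ ≫ c
    rw [← cancel_mono (Limits.image.ι φ), Category.assoc _ c, hc, this, Category.id_comp]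
  have : Epi S.g := hepi
  exact cokCat_of_exact hS k₁ (addCat_image hdim hU φ (addCat_biprod h₀ k₁) k₀)

/-- As `Ext¹(V₀, L) = 0`, the cover `V₀ ⟶ N` lifts to the middle term, which becomes the cokernel of
a map `V₁ ⟶ L ⊞ V₀` in `cok U`; closure under cokernels applies. -/
lemma isClosedUnderExts_cokCat (hdim : ∀ X : A, HasInjectiveDimensionLT X 2) {U : A}
    (hU : IsRigid U) : IsClosedUnderExts (cokCat U) := by
  intro S hS hL hN
  obtain ⟨V₁, V₀, j, q, hjq, k₁, k₀, hSN⟩ := hN.hasShortAddPresentation hdim hU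
  have : Epi q := hSN.epi_g
  have := hSN.mono_f
  have : Mono S.f := hS.mono_f
  obtain ⟨t, ht⟩ := exists_lift_of_extVanishes hS (extVanishes_cokCat hdim hU k₀ hL) q
  have hjt : (j ≫ t) ≫ S.g = 0 := by rw [Category.assoc, ht, hjq]
  let b := hS.exact.lift _ hjt
  have hb : b ≫ S.f = j ≫ t := hS.exact.lift_f _ hjt
  let φ : S.X₁ ⊞ V₀ ⟶ S.X₂ := biprod.desc S.f t
  have hφ : Epi φ := Preadditive.epi_of_cancel_zero _ fun h hh => by
    have e₁ : S.f ≫ h = 0 := by simpa [φ] using biprod.inl ≫= hh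
    have e₂ : t ≫ h = 0 := by simpa [φ] using biprod.inr ≫= hh
    have := hS.epi_g
    have e₃ := hS.exact.g_desc h e₁
    rw [← e₃, ← Category.assoc, ht] at e₂
    rw [← e₃, (cancel_epi q).1 (e₂.trans comp_zero.symm), comp_zero]
  let ψ : V₁ ⟶ S.X₁ ⊞ V₀ := biprod.lift (-b) j
  let S' := ShortComplex.mk ψ φ (by simp [ψ, φ, hb])
  have hS' : S'.Exact := by
    rw [ShortComplex.exact_iff_exact_up_to_refinements]
    intro T x hx
    have hx₁ : (x ≫ biprod.fst) ≫ S.f + (x ≫ biprod.snd) ≫ t = 0 := by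
      rw [← hx, Category.assoc, Category.assoc, ← Preadditive.comp_add]
      congr 1
      change _ = φ
      ext <;> simp [φ]
    have hx₂ : (x ≫ biprod.snd) ≫ q = 0 := by
      have := hx₁ =≫ S.g
      simpa [ht] using this
    obtain ⟨y, hy⟩ : ∃ y, y ≫ j = x ≫ biprod.snd :=
      ⟨hSN.exact.lift _ hx₂, hSN.exact.lift_f _ hx₂⟩
    refine ⟨T, 𝟙 T, inferInstance, y, ?_⟩
    change 𝟙 T ≫ x = _ ≫ ψ
    rw [Category.id_comp]
    refine biprod.hom_ext _ _ ?_ ?_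
    · rw [← cancel_mono S.f, eq_neg_of_add_eq_zero_left hx₁, ← hy]
      simp [ψ, hb]
    · simp [ψ, hy]
  have : Epi S'.g := hφ
  obtain ⟨i⟩ := nonempty_iso_cokernel_of_exact hS'
  exact cokCat_of_iso i.symm (isClosedUnderCokers_cokCat hdim hU ψ (cokCat_of_addCat k₁)
    (cokCat_biprod hL (cokCat_of_addCat k₀)))

lemma isAddSubcategory_cokCat (hdim : ∀ X : A, HasInjectiveDimensionLT X 2) {U : A}
    (hU : IsRigid U) : IsAddSubcategory (cokCat U) where
  iso _ _ := fun ⟨e⟩ => cokCat_of_iso e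
  zero _ hZ := cokCat_of_addCat (addCat_of_isZero U hZ)
  sum _ _ := cokCat_biprod
  summand _ _ := summand_of_isClosedUnderCokers (fun _ _ ⟨e⟩ => cokCat_of_iso e)
    (isClosedUnderCokers_cokCat hdim hU)

/-! ### The resolutions defining `𝒳_U`, and Ext-projectives. -/

lemma cokCat_of_resolvedCat {U X : A} (hX : resolvedCat U X) : cokCat U X := by
  obtain ⟨T, d, p, hp, _, hT, hepi, hex, _⟩ := hX
  have : Epi (ShortComplex.mk (d 0) p hp).g := hepi
  exact cokCat_of_exact hex (hT 1) (hT 0)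

lemma resolvedCat_of_hasShortAddPresentation (hdim : ∀ X : A, HasInjectiveDimensionLT X 2) {U : A}
    (hU : IsRigid U) {X : A} (hX : HasShortAddPresentation U X) : resolvedCat U X := by
  have hcok := cokCat_of_hasShortAddPresentation hX
  have hvan : ∀ {Y : A}, cokCat U Y → ∀ j, 0 < j → ExtVanishes U Y j := by
    intro Y hY j hj
    obtain rfl | hj := (Nat.succ_le_iff.2 hj).eq_or_lt
    · exact extVanishes_cokCat hdim hU (addCat_self U) hY
    · have := hdim Y
      exact HasInjectiveDimensionLT.subsingleton Y 2 j hj U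
  obtain ⟨U₁, U₀, i, p, hip, h₁, h₀, hS⟩ := hX
  have : Mono i := hS.mono_f
  have : Epi p := hS.epi_g
  obtain ⟨Z, hZ⟩ := HasZeroObject.zero (C := A)
  let T : ℕ → A := fun n => match n with
    | 0 => U₀
    | 1 => U₁
    | _ + 2 => Z
  let d : ∀ n, T (n + 1) ⟶ T n := fun n => match n with
    | 0 => i
    | _ + 1 => 0
  have hT : ∀ n, addCat U (T n) := by
    rintro (_ | _ | n)
    exacts [h₀, h₁, addCat_of_isZero U hZ]
  have hd : ∀ n, d (n + 1) ≫ d n = 0 := fun n => hZ.eq_of_src _ _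
  have hdi : ∀ n, cokCat U (image (d n)) := fun n =>
    cokCat_of_addCat (addCat_image hdim hU _ (hT _) (hT _))
  refine ⟨T, d, p, hip, hd, hT, this, hS.exact, ?_, ?_, fun n => hvan (hdi n)⟩
  -- At `U₁` exactness means that `i` is mono; further left the middle term is zero.
  · rintro (_ | n)
    · exact (ShortComplex.exact_iff_mono _ rfl).2 ‹Mono i›
    · exact ShortComplex.exact_of_isZero_X₂ _ hZ
  · have : Epi (Limits.image.ι p) := epi_of_epi_fac (Limits.image.fac p)
    have : IsIso (Limits.image.ι p) := isIso_of_mono_of_epi _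
    exact hvan (cokCat_of_iso (asIso (Limits.image.ι p)).symm hcok)

lemma resolvedCat_tfae (hdim : ∀ X : A, HasInjectiveDimensionLT X 2) {U : A}
    (hU : IsRigid U) (X : A) :
    List.TFAE [resolvedCat U X, cokCat U X, HasShortAddPresentation U X] := by
  tfae_have 1 → 2 := cokCat_of_resolvedCat
  tfae_have 2 → 3 := fun h => h.hasShortAddPresentation hdim hU
  tfae_have 3 → 1 := resolvedCat_of_hasShortAddPresentation hdim hU
  tfae_finish

/-- An Ext-projective splits off the middle term of its own short presentation, because the kernel
of that presentation is in `cok U`. -/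
lemma addCat_eq_extProjectives_cokCat (hdim : ∀ X : A, HasInjectiveDimensionLT X 2) {U : A}
    (hU : IsRigid U) : addCat U = extProjectives (cokCat U) := by
  funext P
  refine propext ⟨fun h => ⟨cokCat_of_addCat h, fun Y => extVanishes_cokCat hdim hU h⟩,
    fun ⟨h, hP⟩ => ?_⟩
  obtain ⟨U₁, U₀, i, p, hip, h₁, h₀, hS⟩ := h.hasShortAddPresentation hdim hU
  obtain ⟨l, hl⟩ := exists_lift_of_extVanishes hS (hP _ (cokCat_of_addCat h₁)) (𝟙 P)
  exact addCat_of_retract h₀ l p hl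

lemma isExtProgenerator_cokCat (hdim : ∀ X : A, HasInjectiveDimensionLT X 2) {U : A}
    (hU : IsRigid U) : IsExtProgenerator (cokCat U) U where
  mem := cokCat_of_addCat (addCat_self U)
  add_eq := addCat_eq_extProjectives_cokCat hdim hU
  enough X hX := by
    obtain ⟨U₁, U₀, i, p, hip, h₁, h₀, hS⟩ := hX.hasShortAddPresentation hdim hU
    rw [addCat_eq_extProjectives_cokCat hdim hU] at h₀
    exact ⟨U₁, U₀, i, p, hip, cokCat_of_addCat h₁, h₀, hS⟩

end Abelian

/-! ### Hereditary rings and finitely generated modules. -/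

/-- If all left ideals are projective, quotients of injective modules are injective. -/
lemma Module.Injective.of_surjective {R : Type u} [Ring R]
    (hR : ∀ I : Ideal R, Module.Projective R I) {Q N : Type u} [AddCommGroup Q] [Module R Q]
    [AddCommGroup N] [Module R N] [Module.Injective R Q] (f : Q →ₗ[R] N)
    (hf : Function.Surjective f) : Module.Injective R N := by
  refine Module.Baer.injective fun I g => ?_
  -- Baer's criterion: a map from the projective ideal `I` lifts to `Q`, extends to the whole ring
  -- there, and is pushed back down to `N`.
  have := hR I
  obtain ⟨h, rfl⟩ := Module.projective_lifting_property f g hf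
  obtain ⟨k, hk⟩ := Module.Baer.of_injective ‹Module.Injective R Q› I h
  exact ⟨f ∘ₗ k, fun x hx => by simp [hk x hx]⟩

/-- Embed `X` in an injective; the quotient is injective too, giving an injective resolution of
length 1. -/
lemma ModuleCat.hasInjectiveDimensionLT_two {R : Type u} [Ring R]
    (hR : ∀ I : Ideal R, Module.Projective R I) (X : ModuleCat.{u} R) :
    HasInjectiveDimensionLT X 2 := by
  obtain ⟨⟨Q, hQ', i, _⟩⟩ := EnoughInjectives.presentation X
  have hS : (ShortComplex.mk i (cokernel.π i) (cokernel.condition i)).ShortExact :=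
    { exact := ShortComplex.exact_cokernel i }
  have hQ : Module.Injective R Q := Module.injective_module_of_injective_object R Q (inj := hQ')
  have hN : Module.Injective R (cokernel i : ModuleCat.{u} R) :=
    Module.Injective.of_surjective (Q := Q) hR (cokernel.π i).hom
      ((ModuleCat.epi_iff_surjective _).1 inferInstance)
  have : Injective (cokernel i) := Module.injective_object_of_injective_module R _ (inj := hN)
  exact hS.hasInjectiveDimensionLT_X₁ 1 inferInstance inferInstance

lemma IsRightHereditary.projective_ideal {Λ : Type u} [Ring Λ] (h : IsRightHereditary Λ)
    (I : Ideal Λᵐᵒᵖ) : Module.Projective Λᵐᵒᵖ I := by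
  let e : Λᵐᵒᵖ ≃ₗ[Λᵐᵒᵖ] Λ :=
    { MulOpposite.opAddEquiv.symm with
      map_smul' := fun _ _ => rfl }
  have := h (Submodule.map e.toLinearMap I)
  exact Module.Projective.of_equiv (e.submoduleMap I).symm

section

attribute [local instance] CategoryTheory.Abelian.hasFiniteBiproducts

lemma isFG_of_addCat {R : Type u} [Ring R] {U X : ModuleCat.{u} R} (hU : ModuleCat.isFG R U)
    (hX : addCat U X) : ModuleCat.isFG R X := by
  have : Module.Finite R U := hU
  obtain ⟨n, s, r, h⟩ := addCat_iff_sum_eq_id.1 hX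
  have hfg : (⨆ i, LinearMap.range (r i).hom).FG :=
    Submodule.fg_iSup _ fun i => Module.Finite.iff_fg.1 inferInstance
  -- As `∑ s i ≫ r i` is the identity, `X` is the sum of the ranges of finitely many maps from `U`.
  suffices htop : ⨆ i, LinearMap.range (r i).hom = ⊤ from ⟨htop ▸ hfg⟩
  refine eq_top_iff.2 fun x _ => ?_
  have hx : ∑ i, (r i).hom ((s i).hom x) = x := by
    simpa [ModuleCat.hom_sum] using congr($(h).hom x)
  rw [← hx]
  exact Submodule.sum_mem _ fun i _ =>
    Submodule.mem_iSup_of_mem i (LinearMap.mem_range_self _ _)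

lemma isFG_of_cokCat {R : Type u} [Ring R] {U X : ModuleCat.{u} R} (hU : ModuleCat.isFG R U)
    (hX : cokCat U X) : ModuleCat.isFG R X := by
  obtain ⟨U₁, U₀, f, _, h₀, ⟨i⟩⟩ := hX
  have : Module.Finite R U₀ := isFG_of_addCat hU h₀
  have : Epi (cokernel.π f ≫ i.inv) := epi_comp _ _
  exact Module.Finite.of_surjective (cokernel.π f ≫ i.inv).hom
    ((ModuleCat.epi_iff_surjective _).1 this)

end

theorem proposition3p4 {R : Type w} {Λ : Type u} [CommRing R] [Ring Λ] [Algebra R Λ]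
    (hΛ : IsArtinAlgebra R Λ) (hered : IsRightHereditary Λ)
    (U : RightMod Λ) (hU : fgRightMod Λ U) (hrigid : IsRigid U) :
    (∀ X : RightMod Λ, fgRightMod Λ X →
      List.TFAE [resolvedCat U X, cokCat U X, HasShortAddPresentation U X]) ∧
    IsICEClosed (cokCat U) ∧
    IsExtProgenerator (cokCat U) U := by
  have hdim := ModuleCat.hasInjectiveDimensionLT_two hered.projective_ideal
  exact ⟨fun X _ => resolvedCat_tfae hdim hrigid X,
    { le_fg := fun _ => isFG_of_cokCat hU
      isAddSubcategory := isAddSubcategory_cokCat hdim hrigid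
      image := isClosedUnderImages_cokCat hdim hrigid
      cokernel := isClosedUnderCokers_cokCat hdim hrigid
      extension := isClosedUnderExts_cokCat hdim hrigid },
    isExtProgenerator_cokCat hdim hrigid⟩
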